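/- **Setting.** Let $\mathbf V$ be a finite set of variables, each $V\in\mathbf V$ with a nonempty measurable domain $\mathcal D_V$, and write $\mathcal D_{\mathbf W}=\prod_{W\in\mathbf W}\mathcal D_W$. A labeled DAG $\mathcal G^{\mathcal L}=(\mathbf V,\mathbf E,\mathcal L)$ is a DAG $(\mathbf V,\mathbf E)$ with, for each edge $(V_i,V_j)$, a (possibly empty) set $\mathcal L_{(V_i,V_j)}$ of labels $\ell\in\mathcal D_{\mathbf V'}$, $\mathbf V'\subseteq\mathbf{Pa}(V_j)\setminus\{V_i\}$. The set $\mathbf C=\mathbf C(\mathcal L)$ of context variables consists of the variables that occur in some label; their domains are assumed countable and discrete. An SCM $M$ on $(\mathbf V,\mathbf E)$ assigns $V\gets f_V(\mathbf{Pa}(V),U_V)$ with measurable $f_V$ and mutually independent exogenous variables $(U_V)_{V\in\mathbf V}$. It satisfies the local context-specific independence $V_i\perp\!\!\!\perp V_j\mid\ell$ if the law of $f_{V_j}(\mathbf{pa},U_{V_j})$ does not depend on the value of $V_i$ as long as $\mathbf{pa}$ agrees with $\ell$. It is compatible with $\mathcal G^{\mathcal L}$, written $M\in\mathcal M_{\langle\mathcal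 G^{\mathcal L}\rangle}$, if it satisfies $V_i\perp\!\!\!\perp V_j\mid\ell$ for every $\ell\in\mathcal L_{(V_i,V_j)}$. A DAG is a labeled DAG without labels. Let $\mathbf O\subseteq\mathbf V$ be the observed variables, $X\in\mathbf O$ the action, $Y\in\mathbf V$ the reward, and $\mathbf{Pa}^\Pi\subseteq\mathbf O\setminus\mathbf{De}(X)$, where $X\in\mathbf{De}(X)$. The policy space $\Pi$ consists of all Markov kernels $\pi(\cdot\mid\mathbf{pa}^\Pi)$ from $\mathcal D_{\mathbf{Pa}^\Pi}$ to $\mathcal D_X$, and $do(\pi)$ replaces the function $f_X$ by the random mechanism $\pi$. $P(y)$ is *imitable* w.r.t. $\langle\mathcal G^{\mathcal L},\Pi\rangle$ if there is a map $\Phi$ from distributions over $\mathbf O$ to $\Pi$ such that $P^M(y\mid do(\Phi(P^M(\mathbf O))))=P^M(y)$ for every $M\in\mathcal M_{\langle\mathcal G^{\mathcal L}\rangle}$, i.e. every compatible model has an imitating policy that is determined by its observational distribution. For a DAG this is classical imitability. For $\mathbf c\in\mathcal D_{\mathbf C}$ let $\mathcal G_{\mathbf c}$ be the DAG on $\mathbf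 V$ obtained from $(\mathbf V,\mathbf E)$ by deleting all edges incident to $\mathbf C$ and all edges $(V_i,V_j)$ that are absent in the context $\mathbf c$, i.e. for which some part $\ell$ of $\mathbf c$, $\ell\in\mathcal D_{\mathbf V'}$ with $\mathbf V'\subseteq\mathbf C\cap\mathbf{Pa}(V_j)\setminus\{V_i\}$, has the property that $V_i\perp\!\!\!\perp V_j\mid\ell$ holds in every $M\in\mathcal M_{\langle\mathcal G^{\mathcal L}\rangle}$ (in particular every edge with a label in $\mathcal L_{(V_i,V_j)}$ that is part of $\mathbf c$). **Proposition.** Assume that $\mathbf{Pa}(\mathbf C(\mathcal L))\subseteq\mathbf C(\mathcal L)$ and $\mathbf C(\mathcal L)\subseteq\mathbf{Pa}^\Pi$. Then $P(y)$ is imitable w.r.t. $\langle\mathcal G^{\mathcal L},\Pi\rangle$ if and only if $P(y)$ is (classically) imitable w.r.t. $\langle\mathcal G_{\mathbf c},\Pi\rangle$ for every $\mathbf c\in\mathcal D_{\mathbf C(\mathcal L)}$. -/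

import Mathlib

open MeasureTheory ProbabilityTheory

universe u v

namespace CSIImitation

/-- A realization of a set of variables: a set `dom` of variables with a value for each of them.
`D w` is the domain of the variable `w`. -/
structure Realization {V : Type v} (D : V → Type u) where
  dom : Set V
  val : ∀ w : dom, D w

/-- A labeled DAG on the vertex set `V`: `edge i j` is the edge `i → j`, and `label i j` is the
set of labels put on that edge, each of them a realization of some parents of `j` other than
`i`. A DAG is a labeled DAG all of whose label sets are empty. -/
structure LDAG {V : Type v} (D : V → Type u) where
  edge : V → V → Prop
  acyclic : ∀ w, ¬ Relation.TransGen edge w w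
  label : V → V → Set (Realization D)
  label_edge : ∀ i j, ∀ l ∈ label i j, edge i j
  label_dom : ∀ i j, ∀ l ∈ label i j, ∀ w ∈ l.dom, edge w j ∧ w ≠ i

namespace LDAG

variable {V : Type v} {D : V → Type u}

/-- The parents of `w`. -/
def Pa (G : LDAG D) (w : V) : Set V := {p | G.edge p w}

/-- The descendants of `x`, including `x` itself. -/
def De (G : LDAG D) (x : V) : Set V := {w | Relation.ReflTransGen G.edge x w}

/-- The context variables: those that occur in some label. -/
def context (G : LDAG D) : Set V := {w | ∃ k j, ∃ l ∈ G.label k j, w ∈ l.dom}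

theorem edge_wf [Finite V] (G : LDAG D) : WellFounded G.edge := by
  have : Std.Irrefl (Relation.TransGen G.edge) := ⟨G.acyclic⟩
  have : IsTrans V (Relation.TransGen G.edge) := ⟨fun _ _ _ => Relation.TransGen.trans⟩
  exact Subrelation.wf (fun h => Relation.TransGen.single h)
    (Finite.wellFounded_of_trans_of_irrefl (Relation.TransGen G.edge))

end LDAG

/-- A structural causal model on the DAG underlying `G`. Each variable `w` has an exogenous
variable with values in `U w` and law `P w`; the exogenous variables are mutually independent
(latent common causes are vertices of the graph). The value of `w` is `f w` applied to the values
of its parents and to its exogenous variable. -/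
structure SCM {V : Type v} {D : V → Type u} [∀ w, MeasurableSpace (D w)] (G : LDAG D) where
  U : V → Type u
  mU : ∀ w, MeasurableSpace (U w)
  P : ∀ w, Measure (U w)
  prob : ∀ w, IsProbabilityMeasure (P w)
  f : ∀ w, (∀ p : G.Pa w, D p) → U w → D w
  measurable_f : ∀ w, Measurable fun a : (∀ p : G.Pa w, D p) × U w => f w a.1 a.2

attribute [instance] SCM.mU SCM.prob

namespace SCM

variable {V : Type v} {D : V → Type u} [∀ w, MeasurableSpace (D w)] {G : LDAG D}

/-- The law of `w` when its parents take the values `pa`. -/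
noncomputable def mechanism (M : SCM G) (w : V) (pa : ∀ p : G.Pa w, D p) : Measure (D w) :=
  (M.P w).map (M.f w pa)

/-- The local context-specific independence of `j` from its parent `i` in the context `l`: as long
as the parents of `j` agree with `l`, the law of `j` given its parents does not depend on the
value of `i`. -/
def LocalCSI (M : SCM G) (i j : V) (l : Realization D) : Prop :=
  ∀ pa pa' : ∀ p : G.Pa j, D p,
    (∀ (p : G.Pa j) (h : (p : V) ∈ l.dom), pa p = l.val ⟨p, h⟩) →
    (∀ (p : G.Pa j) (h : (p : V) ∈ l.dom), pa' p = l.val ⟨p, h⟩) →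
    (∀ p : G.Pa j, (p : V) ≠ i → pa p = pa' p) →
    M.mechanism j pa = M.mechanism j pa'

/-- The model belongs to the class of models compatible with the labeled DAG `G`: each label is
a local context-specific independence of the model. -/
def Compatible (M : SCM G) : Prop :=
  ∀ i j, ∀ l ∈ G.label i j, M.LocalCSI i j l

/-- The values of all variables, as a function of the exogenous variables. -/
noncomputable def sol [Finite V] (M : SCM G) (e : ∀ w, M.U w) : ∀ w, D w :=
  G.edge_wf.fix fun w ih => M.f w (fun p => ih p p.2) (e w)

/-- The joint law of the exogenous variables. -/
noncomputable def noise [Fintype V] (M : SCM G) : Measure (∀ w, M.U w) :=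
  Measure.pi M.P

/-- The joint law of all variables. -/
noncomputable def law [Fintype V] (M : SCM G) : Measure (∀ w, D w) :=
  M.noise.map M.sol

/-- The observational distribution: the joint law of the variables in `O`. -/
noncomputable def obs [Fintype V] (M : SCM G) (O : Set V) : Measure (∀ w : O, D w) :=
  M.law.map fun a w => a w

open Classical in
/-- The values of all variables after the intervention `do(X = x)`, as a function of the exogenous
variables: the function of `X` is replaced by the constant `x`. -/
noncomputable def solDo [Finite V] (M : SCM G) (X : V) (x : D X) (e : ∀ w, M.U w) : ∀ w, D w :=
  G.edge_wf.fix fun w ih => if h : w = X then h ▸ x else M.f w (fun p => ih p p.2) (e w)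

end SCM

/-- The policy space: the stochastic maps from the values of the variables `PaPi` to the action
`X`. -/
def Policy {V : Type v} (D : V → Type u) [∀ w, MeasurableSpace (D w)] (X : V) (PaPi : Set V) :
    Type (max u v) :=
  {π : Kernel (∀ w : PaPi, D w) (D X) // IsMarkovKernel π}

/-- The joint law of all variables after the intervention `do(π)`: the exogenous variables are
drawn, `X` is drawn from `π` at the values of `PaPi` (which are not affected by `X`), and the
other variables follow their own mechanisms. -/
noncomputable def SCM.doPolicy {V : Type v} [Fintype V] {D : V → Type u}
    [∀ w, MeasurableSpace (D w)] {G : LDAG D} (M : SCM G) {X : V} {PaPi : Set V}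
    (π : Policy D X PaPi) : Measure (∀ w, D w) :=
  M.noise.bind fun e => (π.1 fun w => M.sol e w).map fun x => M.solDo X x e

/-- `P(y)` is imitable: a policy that is a function of the observational distribution alone
reproduces the law of `Y`, whatever the model compatible with `G`. -/
def Imitable {V : Type v} [Fintype V] {D : V → Type u} [∀ w, MeasurableSpace (D w)]
    (G : LDAG D) (O : Set V) (X Y : V) (PaPi : Set V) : Prop :=
  ∃ Φ : Measure (∀ w : O, D w) → Policy D X PaPi, ∀ M : SCM G, M.Compatible →
    (M.doPolicy (Φ (M.obs O))).map (fun a => a Y) = M.law.map (fun a => a Y)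

namespace LDAG

variable {V : Type v} {D : V → Type u} [∀ w, MeasurableSpace (D w)]

/-- All labels of the edge `i → j`: the realizations `l` of parents of `j` other than `i` such
that `j` is independent of `i` in the context `l`, in every compatible model. They comprise
`G.label i j` and the independences that follow from the labels of `G` taken together. -/
def fullLabel (G : LDAG D) (i j : V) : Set (Realization D) :=
  {l | (∀ w ∈ l.dom, G.edge w j ∧ w ≠ i) ∧ ∀ M : SCM G, M.Compatible → M.LocalCSI i j l}

/-- The edge `i → j` is absent in the context `c`: it has a label that is part of `c`. -/
def Absent (G : LDAG D) (c : ∀ w : G.context, D w) (i j : V) : Prop :=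
  ∃ l ∈ G.fullLabel i j, ∃ h : l.dom ⊆ G.context, ∀ w : l.dom, l.val w = c ⟨w, h w.2⟩

/-- The context-induced subgraph for a realization `c` of all context variables: the edges that
are absent in the context `c` and the edges incident to a context variable are deleted. No label
is left, so it is a DAG. -/
def induced (G : LDAG D) (c : ∀ w : G.context, D w) : LDAG D where
  edge i j := G.edge i j ∧ i ∉ G.context ∧ j ∉ G.context ∧ ¬ G.Absent c i j
  acyclic w h := G.acyclic w (Relation.TransGen.mono (fun _ _ h => h.1) w w h)
  label _ _ := ∅
  label_edge _ _ _ h := h.elim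
  label_dom _ _ _ h := h.elim

end LDAG

end CSIImitation

/-! Both directions compare models on the labeled DAG with models on the context-induced subgraphs.

From the contexts to the labeled DAG: the context variables have only context variables as parents
and are not descendants of `X`. They can therefore be drawn first, and no policy affects them. Once
they equal `c`, compatibility makes every other mechanism insensitive to parents whose edge is
absent in `c`, so the rest of the model is a model on the induced DAG (`fixContext`). Hence the
observational and every interventional law are mixtures, with the same weights, of the laws of these
models (`context_decomposition`). In a context of positive probability, the observational law of the
fixed model is the conditional law given `c` (`obs_fixContext`), which the observational law of the
whole model determines. The policy that reads `c` from its inputs and then imitates in that context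
imitates overall.

From the labeled DAG to a context: a model on the induced DAG lifts to a compatible model whose
context variables are constantly `c` (`liftContext`). Following the given model only at parents that
agree with `c` would violate labels that identify different contexts. Instead it is followed in
every context that yields the same mechanism as `c` in all compatible models; elsewhere the variable
is constant. Labels preserve this set of contexts, and a label on an edge out of a non-context
variable, met in such a context, forces that edge to be absent in `c` (`absent_of_label`). The
latter uses that absence is defined by all implied independences, not just the listed labels. The
observational law of the lift is the image of the original one under overwriting the context by `c`,
so its imitating policy is available and, fed with `c`, imitates the original model. -/

namespace CSIImitation

/-! ### Replacing coordinates of an assignment -/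

section Overwrite

variable {V : Type v} {D : V → Type u}

open Classical in
/-- The assignment `a` with the values of the variables in `S` replaced by those of `c`. -/
noncomputable def overwrite (S : Set V) (c : ∀ w : S, D w) (a : ∀ w, D w) : ∀ w, D w :=
  fun w => if h : w ∈ S then c ⟨w, h⟩ else a w

theorem overwrite_mem {S : Set V} (c : ∀ w : S, D w) (a : ∀ w, D w) {w : V} (h : w ∈ S) :
    overwrite S c a w = c ⟨w, h⟩ := by
  simp [overwrite, h]

theorem overwrite_notMem {S : Set V} (c : ∀ w : S, D w) (a : ∀ w, D w) {w : V} (h : w ∉ S) :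
    overwrite S c a w = a w := by
  simp [overwrite, h]

theorem measurable_overwrite [∀ w, MeasurableSpace (D w)] (S : Set V) (c : ∀ w : S, D w) :
    Measurable (overwrite (D := D) S c) := by
  refine measurable_pi_lambda _ fun w => ?_
  by_cases h : w ∈ S
  · simp only [overwrite_mem _ _ h]
    exact measurable_const
  · simp only [overwrite_notMem _ _ h]
    exact measurable_pi_apply w

end Overwrite

/-! ### Solutions of a model: recursion, measurability, integrals -/

namespace SCM

variable {V : Type v} {D : V → Type u} [∀ w, MeasurableSpace (D w)] {G : LDAG D}

theorem sol_apply [Finite V] (M : SCM G) (e : ∀ w, M.U w) (w : V) :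
    M.sol e w = M.f w (fun p => M.sol e p) (e w) := by
  unfold sol
  rw [G.edge_wf.fix_eq]

theorem solDo_self [Finite V] (M : SCM G) (X : V) (x : D X) (e : ∀ w, M.U w) :
    M.solDo X x e X = x := by
  unfold solDo
  rw [G.edge_wf.fix_eq]
  simp

theorem solDo_of_ne [Finite V] (M : SCM G) {X w : V} (h : w ≠ X) (x : D X) (e : ∀ w, M.U w) :
    M.solDo X x e w = M.f w (fun p => M.solDo X x e p) (e w) := by
  unfold solDo
  rw [G.edge_wf.fix_eq]
  simp [h]

/-- A variable that is not a descendant of `X` is not affected by an intervention on `X`. -/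
theorem solDo_of_notMem_De [Finite V] (M : SCM G) {X w : V} (hw : w ∉ G.De X) (x : D X)
    (e : ∀ w, M.U w) : M.solDo X x e w = M.sol e w := by
  induction w using G.edge_wf.induction with
  | _ w ih =>
    have hne : w ≠ X := by
      rintro rfl
      exact hw Relation.ReflTransGen.refl
    rw [solDo_of_ne M hne, sol_apply]
    congr 1
    funext p
    exact ih p p.2 fun hp => hw (Relation.ReflTransGen.tail hp p.2)

theorem measurable_sol [Finite V] (M : SCM G) : Measurable M.sol := by
  refine measurable_pi_lambda _ fun w => ?_
  induction w using G.edge_wf.induction with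
  | _ w ih =>
    have h : (fun e => M.sol e w) = fun e => M.f w (fun p => M.sol e p) (e w) :=
      funext fun e => M.sol_apply e w
    rw [h]
    exact (M.measurable_f w).comp
      ((measurable_pi_lambda _ fun p : G.Pa w => ih _ p.2).prodMk (measurable_pi_apply w))

theorem measurable_solDo [Finite V] (M : SCM G) (X : V) :
    Measurable fun q : (∀ w, M.U w) × D X => M.solDo X q.2 q.1 := by
  refine measurable_pi_lambda _ fun w => ?_
  induction w using G.edge_wf.induction with
  | _ w ih =>
    by_cases h : w = X
    · subst h
      simp only [solDo_self]
      exact measurable_snd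
    · have h' : (fun q : (∀ w, M.U w) × D X => M.solDo X q.2 q.1 w) =
          fun q => M.f w (fun p => M.solDo X q.2 q.1 p) (q.1 w) :=
        funext fun q => M.solDo_of_ne h q.2 q.1
      rw [h']
      exact (M.measurable_f w).comp ((measurable_pi_lambda _ fun p : G.Pa w => ih _ p.2).prodMk
        ((measurable_pi_apply w).comp measurable_fst))

theorem measurable_restrict (S : Set V) : Measurable fun (a : ∀ w, D w) (w : S) => a w :=
  measurable_pi_lambda _ fun w => measurable_pi_apply (w : V)

variable [Fintype V]

instance (M : SCM G) : IsProbabilityMeasure M.noise := by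
  unfold noise
  infer_instance

instance (M : SCM G) : IsProbabilityMeasure M.law :=
  Measure.isProbabilityMeasure_map M.measurable_sol.aemeasurable

theorem lintegral_law (M : SCM G) {h : (∀ w, D w) → ENNReal} (hh : Measurable h) :
    ∫⁻ a, h a ∂M.law = ∫⁻ e, h (M.sol e) ∂M.noise :=
  lintegral_map hh M.measurable_sol

theorem measurable_policy_map (M : SCM G) {X : V} {PaPi : Set V} (π : Policy D X PaPi) :
    Measurable fun e => (π.1 fun w => M.sol e w).map fun x => M.solDo X x e := by
  have := π.2
  let κ : Kernel (∀ w, M.U w) (D X) :=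
    π.1.comap (fun e w => M.sol e w) ((measurable_restrict PaPi).comp M.measurable_sol)
  have : IsMarkovKernel κ := Kernel.IsMarkovKernel.comap _ _
  refine Measure.measurable_of_measurable_coe _ fun s hs => ?_
  have hm : ∀ e, Measurable fun x => M.solDo X x e := fun e =>
    (M.measurable_solDo X).comp measurable_prodMk_left
  simp only [Measure.map_apply (hm _) hs]
  exact Kernel.measurable_kernel_prodMk_left (κ := κ) (M.measurable_solDo X hs)

theorem lintegral_doPolicy (M : SCM G) {X : V} {PaPi : Set V} (π : Policy D X PaPi)
    {h : (∀ w, D w) → ENNReal} (hh : Measurable h) :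
    ∫⁻ a, h a ∂M.doPolicy π =
      ∫⁻ e, ∫⁻ x, h (M.solDo X x e) ∂(π.1 fun w => M.sol e w) ∂M.noise := by
  unfold doPolicy
  rw [Measure.lintegral_bind (M.measurable_policy_map π).aemeasurable hh.aemeasurable]
  refine lintegral_congr fun e => lintegral_map hh ?_
  exact (M.measurable_solDo X).comp measurable_prodMk_left

/-- The distribution of a variable after an intervention, as an integral. -/
theorem doPolicy_map_apply (M : SCM G) {X : V} {PaPi : Set V} (π : Policy D X PaPi) (Y : V)
    {B : Set (D Y)} (hB : MeasurableSet B) :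
    (M.doPolicy π).map (fun a => a Y) B =
      ∫⁻ a, B.indicator (fun _ => 1) (a Y) ∂M.doPolicy π := by
  rw [← lintegral_map (f := B.indicator fun _ => 1) (measurable_const.indicator hB)
    (measurable_pi_apply Y)]
  simp [lintegral_indicator hB]

theorem law_map_apply (M : SCM G) (Y : V) {B : Set (D Y)} (hB : MeasurableSet B) :
    M.law.map (fun a => a Y) B = ∫⁻ a, B.indicator (fun _ => 1) (a Y) ∂M.law := by
  rw [← lintegral_map (f := B.indicator fun _ => 1) (measurable_const.indicator hB)
    (measurable_pi_apply Y)]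
  simp [lintegral_indicator hB]

end SCM

/-! ### Iterated redrawing of variables along a topological order -/

section Iterate

variable {V : Type v} {D : V → Type u} [∀ w, MeasurableSpace (D w)]

open Classical in
/-- The expectation of `h` after the variables of the list `L` have been redrawn one after the
other, `w` from the law `κ w` at the current assignment, starting from a given assignment. -/
noncomputable def iterExp (κ : ∀ w, (∀ v, D v) → Measure (D w)) :
    List V → ((∀ v, D v) → ENNReal) → (∀ v, D v) → ENNReal
  | [], h => h
  | w :: L, h => fun a => ∫⁻ y, iterExp κ L h (Function.update a w y) ∂κ w a

theorem iterExp_append (κ : ∀ w, (∀ v, D v) → Measure (D w)) (L L' : List V)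
    (h : (∀ v, D v) → ENNReal) : iterExp κ (L ++ L') h = iterExp κ L (iterExp κ L' h) := by
  induction L with
  | nil => rfl
  | cons w L ih => simp only [List.cons_append, iterExp, ih]

open Classical in
-- `I` is preserved by the redraws, so agreement is needed only on `I`. In the main use, `I`
-- consists of the assignments with a prescribed context.
theorem iterExp_congr {κ κ' : ∀ w, (∀ v, D v) → Measure (D w)} {L : List V}
    {h h' : (∀ v, D v) → ENNReal} (I : Set (∀ v, D v))
    (hI : ∀ b ∈ I, ∀ w ∈ L, ∀ y, Function.update b w y ∈ I)
    (hκ : ∀ b ∈ I, ∀ w ∈ L, κ w b = κ' w b) (hh : ∀ b ∈ I, h b = h' b) :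
    ∀ a ∈ I, iterExp κ L h a = iterExp κ' L h' a := by
  induction L with
  | nil => exact hh
  | cons w L ih =>
    intro a ha
    have hL := ih (fun b hb w hw => hI b hb w (List.mem_cons_of_mem _ hw))
      (fun b hb w hw => hκ b hb w (List.mem_cons_of_mem _ hw))
    simp only [iterExp]
    rw [hκ a ha w List.mem_cons_self]
    exact lintegral_congr fun y => hL _ (hI a ha w List.mem_cons_self y)

/-- Each variable of the list comes after its `R`-predecessors, those in `S` being already
available. -/
def TopoSorted (R : V → V → Prop) : Set V → List V → Prop
  | _, [] => True
  | S, w :: L => (∀ p, R p w → p ∈ S) ∧ TopoSorted R (insert w S) L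

theorem topoSorted_append {R : V → V → Prop} {S : Set V} {L L' : List V} :
    TopoSorted R S (L ++ L') ↔ TopoSorted R S L ∧ TopoSorted R (S ∪ {w | w ∈ L}) L' := by
  induction L generalizing S with
  | nil => simp [TopoSorted]
  | cons w L ih =>
    have : insert w S ∪ {v | v ∈ L} = S ∪ {v | v ∈ w :: L} := by
      ext v
      simp only [Set.mem_union, Set.mem_insert_iff, Set.mem_ofPred_eq, List.mem_cons]
      tauto
    simp only [List.cons_append, TopoSorted, ih, this, and_assoc]

/-- A finite set whose predecessors outside of it are available can be sorted topologically. -/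
theorem exists_topoSorted {R : V → V → Prop} (hR : WellFounded R) (T : Finset V) :
    ∀ S : Set V, (∀ w ∈ T, ∀ p, R p w → p ∈ S ∨ p ∈ T) →
      ∃ L : List V, L.Nodup ∧ (∀ w, w ∈ L ↔ w ∈ T) ∧ TopoSorted R S L := by
  classical
  induction T using Finset.strongInduction with
  | H T ih =>
    intro S hS
    rcases T.eq_empty_or_nonempty with rfl | hT
    · exact ⟨[], List.nodup_nil, by simp, trivial⟩
    · obtain ⟨m, hm, hmin⟩ := hR.has_min (T : Set V) hT
      have hm' : m ∈ T := hm
      obtain ⟨L, hnd, hmem, hL⟩ := ih (T.erase m) (Finset.erase_ssubset hm') (insert m S) (by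
        intro w hw p hp
        rcases hS w (Finset.mem_of_mem_erase hw) p hp with h | h
        · exact Or.inl (Set.mem_insert_of_mem _ h)
        · by_cases hpm : p = m
          · exact Or.inl (hpm ▸ Set.mem_insert _ _)
          · exact Or.inr (Finset.mem_erase.2 ⟨hpm, h⟩))
      refine ⟨m :: L, List.nodup_cons.2 ⟨fun h => ?_, hnd⟩, fun w => ?_, fun p hp => ?_, hL⟩
      · exact Finset.notMem_erase m T ((hmem m).1 h)
      · rw [List.mem_cons, hmem, Finset.mem_erase]
        constructor
        · rintro (rfl | h)
          exacts [hm', h.2]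
        · intro h
          by_cases hwm : w = m
          exacts [Or.inl hwm, Or.inr ⟨hwm, h⟩]
      · exact (hS m hm' p hp).resolve_right fun h => hmin p h hp

/-- If the variables of a topologically sorted list take the values of `s` almost surely once
their predecessors do, then redrawing them writes the values of `s`. -/
theorem iterExp_of_dirac {R : V → V → Prop} {κ : ∀ w, (∀ v, D v) → Measure (D w)}
    {h : (∀ v, D v) → ENNReal} (hm : ∀ L, Measurable (iterExp κ L h)) (s : ∀ v, D v) {L : List V}
    (hκ : ∀ w ∈ L, ∀ a, (∀ p, R p w → a p = s p) → κ w a = Measure.dirac (s w)) {S : Set V}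
    (hL : TopoSorted R S L) {a : ∀ v, D v} (ha : ∀ v ∈ S, a v = s v) (L' : List V) :
    iterExp κ (L ++ L') h a = iterExp κ L' h (overwrite {v | v ∈ L} (fun v => s v) a) := by
  classical
  induction L generalizing S a with
  | nil =>
    congr 1
    funext v
    rw [overwrite_notMem]
    simp
  | cons w L ih =>
    simp only [List.cons_append, iterExp]
    have hmu : Measurable fun y => iterExp κ (L ++ L') h (Function.update a w y) :=
      (hm _).comp (measurable_update a)
    rw [hκ w List.mem_cons_self a fun p hp => ha p (hL.1 p hp), lintegral_dirac' _ hmu,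
      ih (fun w hw => hκ w (List.mem_cons_of_mem _ hw)) hL.2]
    · congr 1
      funext v
      by_cases hv : v ∈ L
      · rw [overwrite_mem _ _ (show v ∈ {v | v ∈ L} from hv),
          overwrite_mem _ _ (show v ∈ {v | v ∈ w :: L} from List.mem_cons_of_mem _ hv)]
      · rw [overwrite_notMem _ _ (show v ∉ {v | v ∈ L} from hv)]
        by_cases hvw : v = w
        · subst hvw
          rw [Function.update_self,
            overwrite_mem _ _ (show v ∈ {u | u ∈ v :: L} from List.mem_cons_self)]
        · rw [Function.update_of_ne hvw, overwrite_notMem]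
          simp [hv, hvw]
    · intro v hv
      by_cases hvw : v = w
      · subst hvw
        simp
      · rw [Function.update_of_ne hvw]
        exact ha v (hv.resolve_left hvw)

/-- The parameter in `E` is for the noise vector: joint measurability in noise and assignment is
what permits Fubini when the noise is averaged out. -/
theorem measurable_iterExp {E : Type*} [MeasurableSpace E]
    (K : ∀ w, Kernel (E × ∀ v, D v) (D w)) [∀ w, IsMarkovKernel (K w)] (L : List V)
    {h : (∀ v, D v) → ENNReal} (hh : Measurable h) :
    Measurable fun q : E × ∀ v, D v => iterExp (fun w b => K w (q.1, b)) L h q.2 := by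
  classical
  induction L with
  | nil => exact hh.comp measurable_snd
  | cons w L ih =>
    simp only [iterExp]
    have hu : Measurable fun r : (E × ∀ v, D v) × D w => (r.1.1, Function.update r.1.2 w r.2) :=
      (measurable_fst.comp measurable_fst).prodMk
        (measurable_update'.comp ((measurable_snd.comp measurable_fst).prodMk measurable_snd))
    exact Measurable.lintegral_kernel_prod_right' (κ := K w) (ih.comp hu)

variable [Fintype V] {U : V → Type u} [∀ w, MeasurableSpace (U w)]

open Classical in
/-- Resampling one coordinate of a product of probability measures. -/
theorem lintegral_pi_resample (P : ∀ w, Measure (U w)) [∀ w, IsProbabilityMeasure (P w)] (w : V)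
    {F : (∀ v, U v) → ENNReal} (hF : Measurable F) :
    ∫⁻ e, F e ∂Measure.pi P = ∫⁻ u, ∫⁻ e, F (Function.update e w u) ∂Measure.pi P ∂P w := by
  have hm : Measurable fun q : (∀ v, U v) × U w => F (Function.update q.1 w q.2) :=
    hF.comp measurable_update'
  have h : ∫⁻ e, F e ∂Measure.pi P =
      ∫⁻ e, ∫⁻ u, F (Function.update e w u) ∂P w ∂Measure.pi P := by
    -- `F` and its average over coordinate `w` have the same marginal in that coordinate.
    refine lintegral_eq_of_lmarginal_eq {w} hF hm.lintegral_prod_right' ?_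
    simp only [lmarginal_singleton, Function.update_idem, lintegral_const, measure_univ, mul_one]
  rw [h]
  exact lintegral_lintegral_swap hm.aemeasurable

/-- Averaging over independent noise variables, one for each redrawn variable, replaces each law
by its average. -/
theorem lintegral_iterExp_noise (P : ∀ w, Measure (U w)) [∀ w, IsProbabilityMeasure (P w)]
    (K : ∀ w, Kernel (U w × ∀ v, D v) (D w)) [∀ w, IsMarkovKernel (K w)] {L : List V}
    (hL : L.Nodup) {h : (∀ v, D v) → ENNReal} (hh : Measurable h) (a : ∀ v, D v) :
    ∫⁻ e, iterExp (fun w b => K w (e w, b)) L h a ∂Measure.pi P =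
      iterExp (fun w b => (P w).bind fun u => K w (u, b)) L h a := by
  classical
  let κ (e : ∀ w, U w) (w : V) (b : ∀ v, D v) : Measure (D w) := K w (e w, b)
  let K' (w : V) : Kernel ((∀ w, U w) × ∀ v, D v) (D w) :=
    (K w).comap (fun q => (q.1 w, q.2))
      (((measurable_pi_apply w).comp measurable_fst).prodMk measurable_snd)
  have hK' : ∀ w, IsMarkovKernel (K' w) := fun w => Kernel.IsMarkovKernel.comap _ _
  have hm : ∀ L, Measurable fun q : (∀ w, U w) × ∀ v, D v => iterExp (κ q.1) L h q.2 :=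
    fun L => measurable_iterExp K' L hh
  change ∫⁻ e, iterExp (κ e) L h a ∂Measure.pi P = _
  induction L generalizing a with
  | nil => simp [iterExp]
  | cons w L ih =>
    obtain ⟨hwL, hL⟩ := List.nodup_cons.1 hL
    -- Without duplicates, the tail never redraws `w` and so ignores the noise of `w`, which can be
    -- integrated out at the head.
    have hupd : ∀ (e : ∀ w, U w) (u : U w) (y : D w),
        iterExp (κ (Function.update e w u)) L h (Function.update a w y) =
          iterExp (κ e) L h (Function.update a w y) := by
      intro e u y
      refine iterExp_congr Set.univ (fun _ _ _ _ _ => trivial) (fun b _ v hv => ?_)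
        (fun _ _ => rfl) _ trivial
      have hvw : v ≠ w := by
        rintro rfl
        exact hwL hv
      simp only [κ, Function.update_of_ne hvw]
    have hme : Measurable fun e => iterExp (κ e) (w :: L) h a :=
      (hm (w :: L)).comp measurable_prodMk_right
    rw [lintegral_pi_resample P w hme]
    simp only [iterExp, hupd]
    have hav : ∀ b, iterExp (fun w b => (P w).bind fun u => K w (u, b)) L h b =
      ∫⁻ e, iterExp (κ e) L h b ∂Measure.pi P := fun b => (ih hL b).symm
    have hma : Measurable fun y : D w => ∫⁻ e, iterExp (κ e) L h (Function.update a w y)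
        ∂Measure.pi P :=
      ((hm L).lintegral_prod_left').comp (measurable_update a)
    simp only [hav]
    have hmK : Measurable fun u => K w (u, a) := (K w).measurable.comp measurable_prodMk_right
    rw [Measure.lintegral_bind hmK.aemeasurable hma.aemeasurable]
    refine lintegral_congr fun u => ?_
    simp only [κ, Function.update_self]
    exact lintegral_lintegral_swap
      ((hm L).comp (measurable_fst.prodMk ((measurable_update a).comp measurable_snd))).aemeasurable

end Iterate

/-! ### Truncated factorization of observational and interventional laws -/

theorem TopoSorted.mem_of_rel {V : Type v} {R : V → V → Prop} {S : Set V} {L : List V}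
    (h : TopoSorted R S L) {p w : V} (hw : w ∈ L) (hp : R p w) : p ∈ S ∨ p ∈ L := by
  induction L generalizing S with
  | nil => simp at hw
  | cons x L ih =>
    rcases List.mem_cons.1 hw with rfl | hw
    · exact Or.inl (h.1 p hp)
    · rcases ih h.2 hw with (rfl | h') | h'
      · exact Or.inr List.mem_cons_self
      · exact Or.inl h'
      · exact Or.inr (List.mem_cons_of_mem _ h')

/-- Adding edges from non-descendants of `X` into `X` keeps a DAG acyclic. -/
theorem LDAG.wellFounded_policyEdge {V : Type v} [Finite V] {D : V → Type u} (G : LDAG D) {X : V}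
    {PaPi : Set V} (h : ∀ p ∈ PaPi, p ∉ G.De X) :
    WellFounded fun p w => G.edge p w ∨ (p ∈ PaPi ∧ w = X) := by
  rw [WellFounded.wellFounded_iff_has_min]
  intro T hT
  -- A minimal element outside `G.De X` has no predecessor in `T`, since predecessors of
  -- non-descendants are non-descendants. If there is none, `T` contains no source of a policy edge,
  -- and minimality for `G.edge` suffices.
  by_cases hne : (T \ G.De X).Nonempty
  · obtain ⟨m, hm, hmin⟩ := G.edge_wf.has_min _ hne
    refine ⟨m, hm.1, fun p hp => ?_⟩
    rintro (hpm | ⟨_, rfl⟩)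
    · exact hmin p ⟨hp, fun hd => hm.2 (Relation.ReflTransGen.tail hd hpm)⟩ hpm
    · exact hm.2 Relation.ReflTransGen.refl
  · obtain ⟨m, hm, hmin⟩ := G.edge_wf.has_min T hT
    refine ⟨m, hm, fun p hp => ?_⟩
    rintro (hpm | ⟨hpi, rfl⟩)
    · exact hmin p hp hpm
    · exact hne ⟨p, hp, h p hpi⟩

namespace SCM

variable {V : Type v} {D : V → Type u} [∀ w, MeasurableSpace (D w)] {G : LDAG D}

/-- The mechanism of `w` as a function of an assignment of all variables. -/
noncomputable def mech (M : SCM G) (w : V) (b : ∀ v, D v) : Measure (D w) :=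
  M.mechanism w fun p => b p

open Classical in
/-- The mechanisms after the intervention `do(π)`. -/
noncomputable def mechDo (M : SCM G) {X : V} {PaPi : Set V} (π : Policy D X PaPi) :
    ∀ w, (∀ v, D v) → Measure (D w) :=
  Function.update M.mech X fun b => π.1 fun w => b w

theorem mechDo_self (M : SCM G) {X : V} {PaPi : Set V} (π : Policy D X PaPi) (b : ∀ v, D v) :
    M.mechDo π X b = π.1 fun w => b w := by
  simp [mechDo]

theorem mechDo_of_ne (M : SCM G) {X w : V} {PaPi : Set V} (π : Policy D X PaPi) (h : w ≠ X) :
    M.mechDo π w = M.mech w := by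
  simp [mechDo, h]

theorem measurable_f_restrict (M : SCM G) (w : V) :
    Measurable fun q : M.U w × ∀ v, D v => M.f w (fun p => q.2 p) q.1 :=
  (M.measurable_f w).comp (((measurable_restrict (G.Pa w)).comp measurable_snd).prodMk
    measurable_fst)

/-- The value of `w` given the noise variable and the assignment, as a deterministic kernel. -/
noncomputable def noiseKernel (M : SCM G) (w : V) : Kernel (M.U w × ∀ v, D v) (D w) :=
  Kernel.deterministic _ (M.measurable_f_restrict w)

instance (M : SCM G) (w : V) : IsMarkovKernel (M.noiseKernel w) := by
  unfold noiseKernel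
  infer_instance

theorem noiseKernel_apply (M : SCM G) (w : V) (q : M.U w × ∀ v, D v) :
    M.noiseKernel w q = Measure.dirac (M.f w (fun p => q.2 p) q.1) :=
  Kernel.deterministic_apply _ _

theorem bind_noiseKernel (M : SCM G) (w : V) (b : ∀ v, D v) :
    (M.P w).bind (fun u => M.noiseKernel w (u, b)) = M.mech w b := by
  simp only [noiseKernel_apply]
  exact Measure.bind_dirac_eq_map _ ((M.measurable_f_restrict w).comp measurable_prodMk_right)

open Classical in
/-- The kernels `noiseKernel` with the one of `X` replaced by the policy. -/
noncomputable def noiseKernelDo (M : SCM G) {X : V} {PaPi : Set V} (π : Policy D X PaPi) :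
    ∀ w, Kernel (M.U w × ∀ v, D v) (D w) :=
  Function.update M.noiseKernel X
    (π.1.comap (fun q w => q.2 w) ((measurable_restrict PaPi).comp measurable_snd))

theorem noiseKernelDo_self (M : SCM G) {X : V} {PaPi : Set V} (π : Policy D X PaPi)
    (q : M.U X × ∀ v, D v) : M.noiseKernelDo π X q = π.1 fun w => q.2 w := by
  simp [noiseKernelDo]

theorem noiseKernelDo_of_ne (M : SCM G) {X w : V} {PaPi : Set V} (π : Policy D X PaPi)
    (h : w ≠ X) : M.noiseKernelDo π w = M.noiseKernel w := by
  simp [noiseKernelDo, h]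

instance (M : SCM G) {X : V} {PaPi : Set V} (π : Policy D X PaPi) (w : V) :
    IsMarkovKernel (M.noiseKernelDo π w) := by
  have := π.2
  by_cases h : w = X
  · subst h
    refine ⟨fun q => ?_⟩
    rw [noiseKernelDo_self]
    infer_instance
  · rw [noiseKernelDo_of_ne M π h]
    infer_instance

theorem bind_noiseKernelDo (M : SCM G) {X : V} {PaPi : Set V} (π : Policy D X PaPi) (w : V)
    (b : ∀ v, D v) :
    (M.P w).bind (fun u => M.noiseKernelDo π w (u, b)) = M.mechDo π w b := by
  by_cases h : w = X
  · subst h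
    simp only [noiseKernelDo_self, mechDo_self]
    simp
  · rw [noiseKernelDo_of_ne M π h, mechDo_of_ne M π h, bind_noiseKernel]

theorem measurable_iterExp_noise {U : V → Type u} [∀ w, MeasurableSpace (U w)]
    (K : ∀ w, Kernel (U w × ∀ v, D v) (D w)) [∀ w, IsMarkovKernel (K w)]
    {h : (∀ v, D v) → ENNReal} (hh : Measurable h) (e : ∀ w, U w) (L : List V) :
    Measurable (iterExp (fun w b => K w (e w, b)) L h) := by
  let K' (w : V) : Kernel ((∀ w, U w) × ∀ v, D v) (D w) :=
    (K w).comap (fun q => (q.1 w, q.2))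
      (((measurable_pi_apply w).comp measurable_fst).prodMk measurable_snd)
  have hK' : ∀ w, IsMarkovKernel (K' w) := fun w => Kernel.IsMarkovKernel.comap _ _
  exact (measurable_iterExp K' L hh).comp measurable_prodMk_left

variable [Fintype V]

/-- Truncated factorization: integrals against the joint law are iterated integrals against the
mechanisms. The variables in `S` are constant and have their value already. -/
theorem lintegral_law_eq_iterExp (M : SCM G) {R : V → V → Prop} (hR : ∀ p w, G.edge p w → R p w)
    {S : Set V} {L : List V} (hnd : L.Nodup) (hL : TopoSorted R S L) (hall : ∀ v, v ∈ S ∨ v ∈ L)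
    {a : ∀ v, D v} (ha : ∀ v ∈ S, ∀ e, a v = M.sol e v)
    {h : (∀ v, D v) → ENNReal} (hh : Measurable h) :
    ∫⁻ b, h b ∂M.law = iterExp M.mech L h a := by
  have hmech : M.mech = fun w b => (M.P w).bind fun u => M.noiseKernel w (u, b) := by
    funext w b
    exact (M.bind_noiseKernel w b).symm
  rw [hmech, ← lintegral_iterExp_noise M.P M.noiseKernel hnd hh a, lintegral_law M hh]
  refine lintegral_congr fun e => ?_
  -- For fixed noise every kernel is a Dirac mass, so redrawing along the order writes the solution.
  have key := iterExp_of_dirac (measurable_iterExp_noise M.noiseKernel hh e) (M.sol e)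
    (fun w _ b hb => by
      rw [noiseKernel_apply, sol_apply]
      congr 2
      funext p
      exact hb p (hR p w p.2)) hL (fun v hv => ha v hv e) []
  rw [List.append_nil] at key
  rw [key]
  simp only [iterExp]
  congr 1
  funext v
  by_cases hv : v ∈ L
  · rw [overwrite_mem _ _ (show v ∈ {v | v ∈ L} from hv)]
  · rw [overwrite_notMem _ _ (show v ∉ {v | v ∈ L} from hv)]
    exact (ha v ((hall v).resolve_right hv) e).symm

/-- The analogue of `lintegral_law_eq_iterExp` for the intervention `do(π)`. -/
theorem lintegral_doPolicy_eq_iterExp (M : SCM G) {X : V} {PaPi : Set V} (π : Policy D X PaPi)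
    {R : V → V → Prop} (hR : ∀ p w, G.edge p w → R p w) (hRX : ∀ p ∈ PaPi, R p X)
    {S : Set V} (hS : ∀ w ∈ S, w ∉ G.De X) {L : List V} (hnd : L.Nodup)
    (hL : TopoSorted R S L) (hall : ∀ v, v ∈ S ∨ v ∈ L)
    {a : ∀ v, D v} (ha : ∀ v ∈ S, ∀ e, a v = M.sol e v)
    {h : (∀ v, D v) → ENNReal} (hh : Measurable h) :
    ∫⁻ b, h b ∂M.doPolicy π = iterExp (M.mechDo π) L h a := by
  classical
  have hmech : M.mechDo π = fun w b => (M.P w).bind fun u => M.noiseKernelDo π w (u, b) := by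
    funext w b
    exact (M.bind_noiseKernelDo π w b).symm
  rw [hmech, ← lintegral_iterExp_noise M.P (M.noiseKernelDo π) hnd hh a, lintegral_doPolicy M π hh]
  refine lintegral_congr fun e => ?_
  have hXS : X ∉ S := fun hX => hS X hX Relation.ReflTransGen.refl
  -- Before `X` the order contains no descendant of `X` but all inputs of the policy, so the redraws
  -- there write `M.sol`; after `X` is drawn, they write `M.solDo`.
  obtain ⟨L₁, L₂, rfl⟩ := List.append_of_mem ((hall X).resolve_left hXS)
  obtain ⟨hL₁, hPa, hL₂⟩ := topoSorted_append.1 hL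
  have hX₁ : X ∉ L₁ := fun hX =>
    (List.nodup_append.1 hnd).2.2 X hX X List.mem_cons_self rfl
  have hX₂ : X ∉ L₂ := (List.nodup_cons.1 (List.nodup_append.1 hnd).2.1).1
  have hde : ∀ w, Relation.ReflTransGen G.edge X w → w ∉ S ∧ w ∉ L₁ := by
    intro w hw
    induction hw with
    | refl => exact ⟨hXS, hX₁⟩
    | @tail p w hp hpw ih =>
      refine ⟨fun h => hS w h (Relation.ReflTransGen.tail hp hpw), fun hw => ?_⟩
      rcases hL₁.mem_of_rel hw (hR p w hpw) with h' | h'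
      exacts [ih.1 h', ih.2 h']
  have hsol : ∀ w x, w ∈ S ∪ {w | w ∈ L₁} → M.solDo X x e w = M.sol e w := by
    intro w x hw
    refine M.solDo_of_notMem_De (fun hd => ?_) x e
    rcases hw with hw | hw
    exacts [(hde w hd).1 hw, (hde w hd).2 hw]
  have hm := measurable_iterExp_noise (M.noiseKernelDo π) hh e
  have hfirst : ∀ w ∈ S ∪ {w | w ∈ L₁},
      overwrite {v | v ∈ L₁} (fun v => M.sol e v) a w = M.sol e w := by
    intro w hw
    by_cases hw₁ : w ∈ L₁
    · rw [overwrite_mem _ _ (show w ∈ {v | v ∈ L₁} from hw₁)]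
    · rw [overwrite_notMem _ _ (show w ∉ {v | v ∈ L₁} from hw₁)]
      exact ha w (hw.resolve_right hw₁) e
  rw [iterExp_of_dirac hm (M.sol e) (fun w hw b hb => by
    have hwX : w ≠ X := by
      rintro rfl
      exact hX₁ hw
    rw [noiseKernelDo_of_ne M π hwX, noiseKernel_apply, sol_apply]
    congr 2
    funext p
    exact hb p (hR p w p.2)) hL₁ (fun v hv => ha v hv e) (X :: L₂)]
  simp only [iterExp, noiseKernelDo_self]
  have hpi : (fun w : PaPi => overwrite {v | v ∈ L₁} (fun v => M.sol e v) a w) =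
      fun w : PaPi => M.sol e w := funext fun w => hfirst w (hPa w (hRX w w.2))
  rw [hpi]
  refine lintegral_congr fun x => ?_
  have hstart : ∀ w ∈ insert X (S ∪ {w | w ∈ L₁}),
      Function.update (overwrite {v | v ∈ L₁} (fun v => M.sol e v) a) X x w =
        M.solDo X x e w := by
    intro w hw
    by_cases hwX : w = X
    · subst hwX
      rw [Function.update_self, solDo_self]
    · rw [Function.update_of_ne hwX, hfirst w (hw.resolve_left hwX),
        hsol w x (hw.resolve_left hwX)]
  have key := iterExp_of_dirac hm (M.solDo X x e) (fun w hw b hb => by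
    have hwX : w ≠ X := by
      rintro rfl
      exact hX₂ hw
    rw [noiseKernelDo_of_ne M π hwX, noiseKernel_apply, solDo_of_ne M hwX]
    congr 2
    funext p
    exact hb p (hR p w p.2)) hL₂ hstart []
  rw [List.append_nil] at key
  rw [key]
  simp only [iterExp]
  congr 1
  funext v
  by_cases hv : v ∈ L₂
  · rw [overwrite_mem _ _ (show v ∈ {v | v ∈ L₂} from hv)]
  · rw [overwrite_notMem _ _ (show v ∉ {v | v ∈ L₂} from hv)]
    refine (hstart v ?_).symm
    rcases hall v with h' | h'
    · exact Or.inr (Or.inl h')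
    · rcases List.mem_append.1 h' with h' | h'
      · exact Or.inr (Or.inr h')
      · exact Or.inl ((List.mem_cons.1 h').resolve_right hv)

end SCM

/-! ### Models with the context variables fixed -/

theorem measurable_overwrite_left {V : Type v} {D : V → Type u} [∀ w, MeasurableSpace (D w)]
    (S : Set V) (a : ∀ w, D w) : Measurable fun c : ∀ w : S, D w => overwrite S c a := by
  refine measurable_pi_lambda _ fun w => ?_
  by_cases h : w ∈ S
  · simp only [overwrite_mem _ _ h]
    exact measurable_pi_apply _
  · simp only [overwrite_notMem _ _ h]
    exact measurable_const

theorem LDAG.De_induced_subset {V : Type v} {D : V → Type u} [∀ w, MeasurableSpace (D w)]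
    (G : LDAG D) (c : ∀ w : G.context, D w) (X : V) : (G.induced c).De X ⊆ G.De X :=
  fun _ h => Relation.ReflTransGen.mono (fun _ _ h => h.1) _ _ h

namespace SCM

variable {V : Type v} {D : V → Type u} [∀ w, MeasurableSpace (D w)] {G : LDAG D}

/-- If two assignments agree with the context `c` and differ only at parents whose edge is absent
in the context `c`, then they yield the same law of the child. -/
theorem mech_eq_of_absent [Fintype V] (M : SCM G) (hM : M.Compatible) (c : ∀ w : G.context, D w)
    (w : V) {b b' : ∀ v, D v} (hb : ∀ v : G.context, b v = c v)
    (hb' : ∀ v : G.context, b' v = c v)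
    (h : ∀ p, G.edge p w → b p ≠ b' p → G.Absent c p w) : M.mech w b = M.mech w b' := by
  classical
  -- A label concerns one parent, so `b` is turned into `b'` one coordinate at a time; the context
  -- stays `c` throughout, which keeps every label applicable.
  have key : ∀ T : Finset V, M.mech w b = M.mech w (overwrite (T : Set V) (fun v => b' v) b) := by
    intro T
    induction T using Finset.induction_on with
    | empty =>
      congr 1
      funext v
      rw [overwrite_notMem]
      simp
    | insert t T ht ih =>
      rw [ih]
      have hoff : ∀ v, v ≠ t → overwrite (T : Set V) (fun v => b' v) b v =
          overwrite ((insert t T : Finset V) : Set V) (fun v => b' v) b v := by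
        intro v hv
        simp [overwrite, hv]
      have hcon : ∀ (T : Finset V) (v : G.context),
          overwrite (T : Set V) (fun v => b' v) b v = c v := by
        intro T v
        by_cases hv : (v : V) ∈ (T : Set V)
        · rw [overwrite_mem _ _ hv, hb']
        · rw [overwrite_notMem _ _ hv, hb]
      by_cases hcase : G.edge t w ∧ b t ≠ b' t
      · obtain ⟨l, hl, hdom, hval⟩ := h t hcase.1 hcase.2
        refine hl.2 M hM _ _ (fun p hp => ?_) (fun p hp => ?_) fun p hp => hoff p hp
        · rw [hval ⟨p, hp⟩]
          exact hcon T ⟨p, hdom hp⟩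
        · rw [hval ⟨p, hp⟩]
          exact hcon (insert t T) ⟨p, hdom hp⟩
      · unfold mech
        congr 1
        funext p
        by_cases hpt : (p : V) = t
        · have hbt : b p = b' p := by
            by_contra hne
            exact hcase ⟨hpt ▸ p.2, hpt ▸ hne⟩
          rw [overwrite_notMem _ _ (by simpa [hpt] using ht),
            overwrite_mem _ _ (by simp [hpt]), hbt]
        · exact hoff p hpt
  rw [key Finset.univ]
  congr 1
  funext v
  rw [overwrite_mem _ _ (by simp)]

theorem measurable_comp_context [Finite V]
    (hdiscrete : ∀ w ∈ G.context, Countable (D w) ∧ DiscreteMeasurableSpace (D w))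
    {γ : Type*} [MeasurableSpace γ] (g : (∀ w : G.context, D w) → γ) : Measurable g := by
  have h1 : ∀ w : G.context, Countable (D w) := fun w => (hdiscrete w w.2).1
  have h2 : ∀ w : G.context, DiscreteMeasurableSpace (D w) := fun w => (hdiscrete w w.2).2
  exact Measurable.of_discrete

/-- Almost surely, the context variables take a value of positive probability. -/
theorem ae_context_ne_zero [Fintype V] (M : SCM G)
    (hdiscrete : ∀ w ∈ G.context, Countable (D w) ∧ DiscreteMeasurableSpace (D w)) :
    ∀ᵐ a ∂M.law, M.law {b | ∀ w : G.context, b w = a w} ≠ 0 := by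
  have h1 : ∀ w : G.context, Countable (D w) := fun w => (hdiscrete w w.2).1
  rw [ae_iff]
  refine measure_mono_null (t := ⋃ (c : ∀ w : G.context, D w)
    (_ : M.law {b | ∀ w : G.context, b w = c w} = 0), {b | ∀ w : G.context, b w = c w})
    (fun a ha => ?_) ?_
  · simp only [Set.mem_iUnion]
    exact ⟨fun w => a w, not_not.1 ha, fun _ => rfl⟩
  · exact measure_iUnion_null fun c => measure_iUnion_null fun h => h

theorem measurableSet_context [Finite V]
    (hdiscrete : ∀ w ∈ G.context, Countable (D w) ∧ DiscreteMeasurableSpace (D w))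
    {O : Set V} (hO : G.context ⊆ O) (c : ∀ w : G.context, D w) :
    MeasurableSet {o : ∀ w : O, D w | ∀ w : G.context, o ⟨w, hO w.2⟩ = c w} := by
  simp only [Set.ofPred_forall]
  refine MeasurableSet.iInter fun w => ?_
  have := (hdiscrete w w.2).2
  have hs : MeasurableSet {c w} := MeasurableSet.of_discrete
  exact hs.preimage (measurable_pi_apply (⟨w, hO w.2⟩ : O))

variable [∀ w, Nonempty (D w)]

open Classical in
/-- The model on the context-induced subgraph that is obtained from `M` by setting the context
variables to `c`, and the parents along deleted edges to arbitrary values. -/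
noncomputable def fixContext (M : SCM G) (c : ∀ w : G.context, D w) : SCM (G.induced c) where
  U := M.U
  mU := M.mU
  P := M.P
  prob := M.prob
  f w pa u := if h : w ∈ G.context then c ⟨w, h⟩ else
    M.f w (fun p => overwrite G.context c
      (overwrite ((G.induced c).Pa w) pa fun _ => Classical.arbitrary _) p) u
  measurable_f w := by
    by_cases h : w ∈ G.context
    · simp only [h, dif_pos]
      exact measurable_const
    · simp only [h, dif_neg, not_false_iff]
      have hpa : Measurable fun a : (∀ p : (G.induced c).Pa w, D p) × M.U w =>
          overwrite G.context c
            (overwrite ((G.induced c).Pa w) a.1 fun _ => Classical.arbitrary _) :=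
        (measurable_overwrite _ c).comp ((measurable_overwrite_left _ _).comp measurable_fst)
      exact (M.measurable_f w).comp
        (((measurable_restrict (G.Pa w)).comp hpa).prodMk measurable_snd)

theorem mech_fixContext [Fintype V] (M : SCM G) (hM : M.Compatible) (c : ∀ w : G.context, D w)
    {w : V} (hw : w ∉ G.context) {b : ∀ v, D v} (hb : ∀ v : G.context, b v = c v) :
    (M.fixContext c).mech w b = M.mech w b := by
  have h1 : (M.fixContext c).mech w b = M.mech w (overwrite G.context c
      (overwrite ((G.induced c).Pa w) (fun p => b p) fun _ => Classical.arbitrary _)) := by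
    simp only [mech, mechanism, fixContext, hw, dif_neg, not_false_iff]
    rfl
  rw [h1]
  -- As `w` is not a context variable, a non-context parent whose edge is deleted must have lost it
  -- by absence; only such parents received arbitrary values.
  refine M.mech_eq_of_absent hM c w (fun v => overwrite_mem _ _ v.2) hb fun p hp hne => ?_
  by_contra habs
  apply hne
  by_cases hpc : p ∈ G.context
  · rw [overwrite_mem _ _ hpc, hb ⟨p, hpc⟩]
  · have : p ∈ (G.induced c).Pa w := ⟨hp, hpc, hw, habs⟩
    rw [overwrite_notMem _ _ hpc, overwrite_mem _ _ this]

theorem sol_fixContext [Finite V] (M : SCM G) (c : ∀ w : G.context, D w) 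
    (e : ∀ w, (M.fixContext c).U w) (v : G.context) : (M.fixContext c).sol e v = c v := by
  rw [sol_apply]
  simp [fixContext]

/-! ### The laws of a model as mixtures over contexts -/

variable [Fintype V]

/-- Integrals against the joint law decompose along the values of the context variables: first
the context variables are drawn, then the other variables in the corresponding context. -/
theorem exists_context_decomposition (M : SCM G) (hM : M.Compatible) {X : V} {PaPi : Set V}
    (hPaPi : ∀ p ∈ PaPi, p ∉ G.De X) (hcontext : G.context ⊆ PaPi)
    (hparents : ∀ w ∈ G.context, G.Pa w ⊆ G.context) :
    ∃ J : ((∀ w, D w) → ENNReal) → ENNReal,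
      (∀ h, Measurable h →
        ∫⁻ a, h a ∂M.law = J fun a => ∫⁻ b, h b ∂(M.fixContext fun w => a w).law) ∧
      ∀ (π : Policy D X PaPi) (h), Measurable h →
        ∫⁻ a, h a ∂M.doPolicy π = J fun a => ∫⁻ b, h b ∂(M.fixContext fun w => a w).doPolicy π := by
  classical
  -- A single order serves `M`, the intervention and all the fixed models, whose edges are among
  -- those of `G`.
  let R : V → V → Prop := fun p w => G.edge p w ∨ (p ∈ PaPi ∧ w = X)
  have hR : WellFounded R := G.wellFounded_policyEdge hPaPi
  have hXC : X ∉ G.context := fun h => hPaPi X (hcontext h) Relation.ReflTransGen.refl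
  obtain ⟨L₁, hnd₁, hmem₁, hL₁⟩ := exists_topoSorted hR G.context.toFinset ∅ (by
    rintro w hw p (hp | ⟨_, rfl⟩)
    · exact Or.inr (Set.mem_toFinset.2 (hparents w (Set.mem_toFinset.1 hw) hp))
    · exact absurd (Set.mem_toFinset.1 hw) hXC)
  obtain ⟨L₂, hnd₂, hmem₂, hL₂⟩ := exists_topoSorted hR G.contextᶜ.toFinset G.context (by
    intro w _ p _
    by_cases hp : p ∈ G.context
    · exact Or.inl hp
    · exact Or.inr (Set.mem_toFinset.2 hp))
  simp only [Set.mem_toFinset, Set.mem_compl_iff] at hmem₁ hmem₂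
  have hset : ∅ ∪ {w | w ∈ L₁} = G.context := by
    ext w
    simp [hmem₁]
  have hL : TopoSorted R ∅ (L₁ ++ L₂) := topoSorted_append.2 ⟨hL₁, hset ▸ hL₂⟩
  have hnd : (L₁ ++ L₂).Nodup := List.nodup_append.2 ⟨hnd₁, hnd₂, by
    rintro v hv _ hv' rfl
    exact (hmem₂ v).1 hv' ((hmem₁ v).1 hv)⟩
  have hall₂ : ∀ v, v ∈ G.context ∨ v ∈ L₂ := fun v => by
    rw [hmem₂]
    exact em _
  have hall : ∀ v, v ∈ (∅ : Set V) ∨ v ∈ L₁ ++ L₂ := fun v => by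
    rw [List.mem_append, hmem₁, hmem₂]
    exact Or.inr (em _)
  -- The starting values are irrelevant, since the whole list redraws every variable.
  let a₀ : ∀ v, D v := fun _ => Classical.arbitrary _
  have hinv : ∀ a : ∀ v, D v, ∀ b ∈ {b : ∀ v, D v | ∀ v : G.context, b v = a v},
      ∀ w ∈ L₂, ∀ y, Function.update b w y ∈ {b : ∀ v, D v | ∀ v : G.context, b v = a v} := by
    intro a b hb w hw y v
    have hvw : (v : V) ≠ w := by
      rintro rfl
      exact (hmem₂ _).1 hw v.2
    rw [Function.update_of_ne hvw, hb v]
  have hsub : ∀ (c : ∀ w : G.context, D w) p w, (G.induced c).edge p w → R p w :=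
    fun c p w h => Or.inl h.1
  -- `J` redraws only context variables. As `X` is not among them, it is the same functional under
  -- every policy.
  refine ⟨fun g => iterExp M.mech L₁ g a₀, fun h hh => ?_, fun π h hh => ?_⟩
  · rw [M.lintegral_law_eq_iterExp (fun p w h => Or.inl h) hnd hL hall (a := a₀)
      (fun v hv => hv.elim) hh, iterExp_append]
    congr 1
    funext a
    rw [(M.fixContext fun w => a w).lintegral_law_eq_iterExp (hsub _) hnd₂ hL₂ hall₂ (a := a)
      (fun v hv e => (M.sol_fixContext (fun w => a w) e ⟨v, hv⟩).symm) hh]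
    exact iterExp_congr _ (hinv a)
      (fun b hb w hw => (M.mech_fixContext hM _ ((hmem₂ w).1 hw) hb).symm) (fun _ _ => rfl) a
      fun _ => rfl
  · rw [M.lintegral_doPolicy_eq_iterExp π (fun p w h => Or.inl h) (fun p hp => Or.inr ⟨hp, rfl⟩)
      (fun v hv => hv.elim) hnd hL hall (a := a₀) (fun v hv => hv.elim) hh, iterExp_append]
    refine iterExp_congr Set.univ (fun _ _ _ _ _ => trivial) (fun b _ w hw => ?_) (fun a _ => ?_)
      a₀ trivial
    · rw [M.mechDo_of_ne]
      rintro rfl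
      exact hXC ((hmem₁ _).1 hw)
    · rw [(M.fixContext fun w => a w).lintegral_doPolicy_eq_iterExp π (hsub _)
        (fun p hp => Or.inr ⟨hp, rfl⟩)
        (fun w hw hd => hPaPi w (hcontext hw) (G.De_induced_subset _ X hd)) hnd₂ hL₂ hall₂ (a := a)
        (fun v hv e => (M.sol_fixContext (fun w => a w) e ⟨v, hv⟩).symm) hh]
      refine iterExp_congr _ (hinv a) (fun b hb w hw => ?_) (fun _ _ => rfl) a fun _ => rfl
      by_cases hwX : w = X
      · subst hwX
        rw [mechDo_self, mechDo_self]
      · rw [mechDo_of_ne _ _ hwX, mechDo_of_ne _ _ hwX]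
        exact (M.mech_fixContext hM _ ((hmem₂ w).1 hw) hb).symm

theorem context_decomposition (M : SCM G) (hM : M.Compatible) {X : V} {PaPi : Set V}
    (hPaPi : ∀ p ∈ PaPi, p ∉ G.De X) (hcontext : G.context ⊆ PaPi)
    (hparents : ∀ w ∈ G.context, G.Pa w ⊆ G.context)
    (hdiscrete : ∀ w ∈ G.context, Countable (D w) ∧ DiscreteMeasurableSpace (D w)) :
    (∀ h : (∀ w, D w) → ENNReal, Measurable h →
      ∫⁻ a, h a ∂M.law = ∫⁻ a, ∫⁻ b, h b ∂(M.fixContext fun w => a w).law ∂M.law) ∧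
    ∀ (π : Policy D X PaPi) (h : (∀ w, D w) → ENNReal), Measurable h →
      ∫⁻ a, h a ∂M.doPolicy π =
        ∫⁻ a, ∫⁻ b, h b ∂(M.fixContext fun w => a w).doPolicy π ∂M.law := by
  obtain ⟨J, hJ, hJdo⟩ := M.exists_context_decomposition hM hPaPi hcontext hparents
  -- The functional is identified by applying its own defining identity to a function of the
  -- context: the inner integral is then trivial, because the fixed model has a constant context.
  have hg : ∀ g : (∀ w : G.context, D w) → ENNReal,
      ∫⁻ a, g (fun w => a w) ∂M.law = J fun a => g fun w => a w := by
    intro g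
    have hm : Measurable fun a : ∀ w, D w => g fun w => a w :=
      (measurable_comp_context hdiscrete g).comp (measurable_restrict G.context)
    rw [hJ _ hm]
    congr 1
    funext a
    rw [lintegral_law _ hm]
    simp only [sol_fixContext, lintegral_const, measure_univ, mul_one]
  exact ⟨fun h hh => (hJ h hh).trans
      (hg fun c => ∫⁻ b, h b ∂(M.fixContext c).law).symm,
    fun π h hh => (hJdo π h hh).trans
      (hg fun c => ∫⁻ b, h b ∂(M.fixContext c).doPolicy π).symm⟩

/-- The observational distribution in a context of positive probability is the conditional
distribution given the context. -/
theorem obs_fixContext (M : SCM G) (hM : M.Compatible) {X : V} {PaPi : Set V}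
    (hPaPi : ∀ p ∈ PaPi, p ∉ G.De X) (hcontext : G.context ⊆ PaPi)
    (hparents : ∀ w ∈ G.context, G.Pa w ⊆ G.context)
    (hdiscrete : ∀ w ∈ G.context, Countable (D w) ∧ DiscreteMeasurableSpace (D w))
    {O : Set V} (hO : G.context ⊆ O) (c : ∀ w : G.context, D w)
    (hc : M.law {b | ∀ w : G.context, b w = c w} ≠ 0) :
    (M.fixContext c).obs O =
      cond (M.obs O) {o : ∀ w : O, D w | ∀ w : G.context, o ⟨w, hO w.2⟩ = c w} := by
  have hS := measurableSet_context hdiscrete hO c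
  have hSV : MeasurableSet {b : ∀ w, D w | ∀ w : G.context, b w = c w} :=
    measurable_restrict O hS
  have hdec := (M.context_decomposition hM hPaPi hcontext hparents hdiscrete).1
  ext A hA
  rw [cond_apply hS]
  unfold obs
  rw [Measure.map_apply (measurable_restrict O) hA, Measure.map_apply (measurable_restrict O) hS,
    Measure.map_apply (measurable_restrict O) (hS.inter hA)]
  set T : Set (∀ w, D w) := (fun a (w : O) => a w) ⁻¹' A with hT
  have hTm : MeasurableSet T := measurable_restrict O hA
  change _ = (M.law {b | ∀ w : G.context, b w = c w})⁻¹ *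
    M.law ({b | ∀ w : G.context, b w = c w} ∩ T)
  -- In the mixture for this event, contexts other than `c` contribute nothing, and `c` contributes
  -- the probability of `T` in the fixed model.
  have key : M.law ({b | ∀ w : G.context, b w = c w} ∩ T) =
      (M.fixContext c).law T * M.law {b | ∀ w : G.context, b w = c w} := by
    rw [← lintegral_indicator_one (hSV.inter hTm),
      hdec _ (measurable_one.indicator (hSV.inter hTm)), ← lintegral_indicator_const hSV]
    refine lintegral_congr fun a => ?_
    rw [lintegral_indicator_one (hSV.inter hTm)]
    have hlaw : ∀ (c' : ∀ w : G.context, D w) (Q : Set (∀ w, D w)), MeasurableSet Q →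
        (M.fixContext c').law Q = (M.fixContext c').noise ((M.fixContext c').sol ⁻¹' Q) :=
      fun c' Q hQ => Measure.map_apply (M.fixContext c').measurable_sol hQ
    by_cases ha : ∀ w : G.context, a w = c w
    · have hac : (fun w : G.context => a w) = c := funext ha
      rw [Set.indicator_of_mem (show a ∈ {b | ∀ w : G.context, b w = c w} from ha), hac,
        hlaw _ _ (hSV.inter hTm), hlaw _ _ hTm]
      congr 1
      ext e
      exact ⟨fun h => h.2, fun h => ⟨fun w => M.sol_fixContext c e w, h⟩⟩
    · rw [Set.indicator_of_notMem (show a ∉ {b | ∀ w : G.context, b w = c w} from ha),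
        hlaw _ _ (hSV.inter hTm)]
      convert measure_empty (μ := (M.fixContext fun w => a w).noise)
      refine Set.eq_empty_of_forall_notMem fun e he => ha ?_
      have he' : ∀ w : G.context, (M.fixContext fun w => a w).sol e w = c w := he.1
      simpa only [sol_fixContext] using he'
  rw [key, mul_comm, mul_assoc, ENNReal.mul_inv_cancel hc (measure_ne_top _ _), mul_one]

end SCM

/-! ### From the contexts to the labeled DAG -/

/-- The policy that chooses a policy by the values of the context variables and follows it. -/
noncomputable def contextPolicy {V : Type v} [Finite V] {D : V → Type u}
    [∀ w, MeasurableSpace (D w)] {X : V} {PaPi C : Set V} (hC : C ⊆ PaPi)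
    (hdiscrete : ∀ w ∈ C, Countable (D w) ∧ DiscreteMeasurableSpace (D w))
    (F : (∀ w : C, D w) → Policy D X PaPi) : Policy D X PaPi :=
  ⟨{ toFun := fun pa => (F fun w => pa ⟨w, hC w.2⟩).1 pa
     measurable' := by
      have h1 : ∀ w : C, Countable (D w) := fun w => (hdiscrete w w.2).1
      have h2 : ∀ w : C, DiscreteMeasurableSpace (D w) := fun w => (hdiscrete w w.2).2
      have hm : Measurable fun q : (∀ w : PaPi, D w) × (∀ w : C, D w) => (F q.2).1 q.1 :=
        measurable_from_prod_countable_left fun c => (F c).1.measurable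
      have hr : Measurable fun (pa : ∀ w : PaPi, D w) (w : C) => pa ⟨w, hC w.2⟩ :=
        measurable_pi_lambda _ fun w => measurable_pi_apply _
      exact hm.comp (measurable_id.prodMk hr) },
    ⟨fun pa => (F fun w => pa ⟨w, hC w.2⟩).2.isProbabilityMeasure pa⟩⟩

theorem imitable_of_forall_induced {V : Type v} [Fintype V] {D : V → Type u}
    [∀ w, MeasurableSpace (D w)] [∀ w, Nonempty (D w)]
    (G : LDAG D) (O : Set V) (X Y : V) (PaPi : Set V) (hPaPi : PaPi ⊆ O \ G.De X)
    (hdiscrete : ∀ w ∈ G.context, Countable (D w) ∧ DiscreteMeasurableSpace (D w))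
    (hcontext : G.context ⊆ PaPi) (hparents : ∀ w ∈ G.context, G.Pa w ⊆ G.context)
    (h : ∀ c : (∀ w : G.context, D w), Imitable (G.induced c) O X Y PaPi) :
    Imitable G O X Y PaPi := by
  choose Φ hΦ using h
  have hO : G.context ⊆ O := fun w hw => (hPaPi (hcontext hw)).1
  have hDe : ∀ p ∈ PaPi, p ∉ G.De X := fun p hp => (hPaPi hp).2
  -- Conditioning on a null context gives a meaningless input to `Φ c`, which is harmless because
  -- only contexts of positive probability enter the mixture.
  refine ⟨fun P => contextPolicy hcontext hdiscrete fun c =>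
    Φ c (cond P {o : ∀ w : O, D w | ∀ w : G.context, o ⟨w, hO w.2⟩ = c w}), fun M hM => ?_⟩
  obtain ⟨hlaw, hdo⟩ := M.context_decomposition hM hDe hcontext hparents hdiscrete
  ext B hB
  have hB' : Measurable fun a : ∀ w, D w => B.indicator (fun _ => (1 : ENNReal)) (a Y) :=
    (measurable_const.indicator hB).comp (measurable_pi_apply Y)
  rw [M.doPolicy_map_apply _ Y hB, M.law_map_apply Y hB, hlaw _ hB', hdo _ _ hB']
  refine lintegral_congr_ae ?_
  filter_upwards [M.ae_context_ne_zero hdiscrete] with a ha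
  have hcomp : (M.fixContext fun w => a w).Compatible := fun _ _ _ hl => hl.elim
  have hobs := M.obs_fixContext hM hDe hcontext hparents hdiscrete hO (fun w => a w) ha
  rw [← SCM.doPolicy_map_apply _ _ Y hB, ← SCM.law_map_apply _ Y hB,
    ← hΦ (fun w => a w) (M.fixContext fun w => a w) hcomp, hobs]
  congr 2
  unfold SCM.doPolicy
  congr 1
  funext e
  congr 1
  -- In the fixed model the context read from the inputs is the fixed one, so the glued policy acts
  -- as the policy chosen for that context.
  change (Φ (fun w => (M.fixContext fun w => a w).sol e w) _).1 _ = _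
  simp only [SCM.sol_fixContext]

/-! ### Lifting a model from an induced subgraph to the labeled DAG -/

section ReadContext

variable {V : Type v} {D : V → Type u} [∀ w, Nonempty (D w)] {G : LDAG D}
  {c : ∀ w : G.context, D w}

/-- The context that is read off the parents `pa` of `w`, and is `c` elsewhere. -/
noncomputable def LDAG.readContext (G : LDAG D) (c : ∀ w : G.context, D w) (w : V)
    (pa : ∀ p : G.Pa w, D p) : ∀ v : G.context, D v :=
  fun v => overwrite (G.Pa w) pa (overwrite G.context c fun _ => Classical.arbitrary _) v

theorem LDAG.readContext_of_edge {w : V} (pa : ∀ p : G.Pa w, D p) {v : G.context}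
    (h : G.edge v w) : G.readContext c w pa v = pa ⟨v, h⟩ :=
  overwrite_mem _ _ (show (v : V) ∈ G.Pa w from h)

theorem LDAG.readContext_of_not_edge {w : V} (pa : ∀ p : G.Pa w, D p) {v : G.context}
    (h : ¬ G.edge v w) : G.readContext c w pa v = c v := by
  unfold LDAG.readContext
  rw [overwrite_notMem _ _ (show (v : V) ∉ G.Pa w from h), overwrite_mem _ _ v.2]

end ReadContext

section Lift

variable {V : Type v} {D : V → Type u} [∀ w, MeasurableSpace (D w)]

/-- In every model compatible with `G`, the contexts `d` and `c` yield the same mechanism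
of `j`. -/
def LDAG.SameMechanism (G : LDAG D) (c : ∀ w : G.context, D w) (j : V)
    (d : ∀ w : G.context, D w) : Prop :=
  ∀ M : SCM G, M.Compatible → ∀ b : ∀ v, D v,
    M.mech j (overwrite G.context d b) = M.mech j (overwrite G.context c b)

/-- A label of the edge `i → j` makes the mechanism of `j` insensitive to `i`. -/
theorem SCM.mech_eq_of_label {G : LDAG D} {M : SCM G} (hM : M.Compatible) {i j : V}
    {l : Realization D} (hl : l ∈ G.label i j) {b b' : ∀ v, D v}
    (hb : ∀ w : l.dom, b w = l.val w) (hb' : ∀ w : l.dom, b' w = l.val w)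
    (h : ∀ p, G.edge p j → p ≠ i → b p = b' p) : M.mech j b = M.mech j b' :=
  hM i j l hl _ _ (fun p hp => hb ⟨p, hp⟩) (fun p hp => hb' ⟨p, hp⟩) fun p hp => h p p.2 hp

/-- Both contexts lie within the label and differ, among the parents of `j`, at most at `i`, so
every compatible model has the same mechanism in both. This makes the case distinction in
`liftContext` respect the labels. -/
theorem LDAG.sameMechanism_of_label {G : LDAG D} {c d d' : ∀ w : G.context, D w} {i j : V}
    {l : Realization D} (hl : l ∈ G.label i j)
    (hd : ∀ (w : G.context) (h : (w : V) ∈ l.dom), d w = l.val ⟨w, h⟩)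
    (hd' : ∀ (w : G.context) (h : (w : V) ∈ l.dom), d' w = l.val ⟨w, h⟩)
    (h : ∀ w : G.context, G.edge w j → (w : V) ≠ i → d w = d' w)
    (hs : G.SameMechanism c j d) : G.SameMechanism c j d' := by
  intro M hM b
  rw [← hs M hM b]
  have hdom : ∀ w ∈ l.dom, w ∈ G.context := fun w hw => ⟨i, j, l, hl, hw⟩
  refine SCM.mech_eq_of_label hM hl (fun w => ?_) (fun w => ?_) fun p hp hpi => ?_
  · rw [overwrite_mem _ _ (hdom w w.2), hd' ⟨w, hdom w w.2⟩ w.2]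
  · rw [overwrite_mem _ _ (hdom w w.2), hd ⟨w, hdom w w.2⟩ w.2]
  · by_cases hpc : p ∈ G.context
    · rw [overwrite_mem _ _ hpc, overwrite_mem _ _ hpc]
      exact (h ⟨p, hpc⟩ hp hpi).symm
    · rw [overwrite_notMem _ _ hpc, overwrite_notMem _ _ hpc]

/-- If `i → j` is labeled in a context with the same mechanism as `c`, the edge is absent in the
context `c`. -/
theorem LDAG.absent_of_label [∀ w, Nonempty (D w)] {G : LDAG D} {c d : ∀ w : G.context, D w}
    {i j : V} {l : Realization D} (hl : l ∈ G.label i j) (hi : i ∉ G.context)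
    (hd : ∀ (w : G.context) (h : (w : V) ∈ l.dom), d w = l.val ⟨w, h⟩)
    (hs : G.SameMechanism c j d) : G.Absent c i j := by
  have hdom : ∀ w ∈ l.dom, w ∈ G.context := fun w hw => ⟨i, j, l, hl, hw⟩
  -- The witness is the largest candidate: all of `c` on the context parents of `j`. It does not
  -- involve `i`, which is not a context variable.
  refine ⟨⟨G.context ∩ G.Pa j, fun w => c ⟨w, w.2.1⟩⟩, ⟨fun w hw => ⟨hw.2, ?_⟩, ?_⟩,
    fun w hw => hw.1, fun w => rfl⟩
  · rintro rfl
    exact hi hw.1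
  · intro M hM q q' hq hq' hqq
    let ext (q : ∀ p : G.Pa j, D p) : ∀ v, D v :=
      overwrite (G.Pa j) q fun _ => Classical.arbitrary _
    -- Parents that agree with `c` may be moved to the context `d` without changing the mechanism,
    -- and there `l` applies.
    have hext : ∀ q, (∀ (p : G.Pa j) (h : (p : V) ∈ G.context ∩ G.Pa j), q p = c ⟨p, h.1⟩) →
        M.mechanism j q = M.mech j (overwrite G.context d (ext q)) := by
      intro q hq
      rw [hs M hM]
      unfold SCM.mech
      congr 1
      funext p
      by_cases hp : (p : V) ∈ G.context
      · rw [overwrite_mem _ _ hp]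
        exact hq p ⟨hp, p.2⟩
      · rw [overwrite_notMem _ _ hp]
        exact (overwrite_mem _ _ p.2).symm
    rw [hext q hq, hext q' hq']
    refine SCM.mech_eq_of_label hM hl (fun w => ?_) (fun w => ?_) fun p hp hpi => ?_
    · rw [overwrite_mem _ _ (hdom w w.2), hd ⟨w, hdom w w.2⟩ w.2]
    · rw [overwrite_mem _ _ (hdom w w.2), hd ⟨w, hdom w w.2⟩ w.2]
    · by_cases hpc : p ∈ G.context
      · rw [overwrite_mem _ _ hpc, overwrite_mem _ _ hpc]
      · rw [overwrite_notMem _ _ hpc, overwrite_notMem _ _ hpc]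
        have hp' : p ∈ G.Pa j := hp
        simp only [ext, overwrite_mem _ _ hp']
        exact hqq ⟨p, hp'⟩ hpi

variable [∀ w, Nonempty (D w)] {G : LDAG D} {c : ∀ w : G.context, D w}

namespace SCM

open Classical in
/-- The model on the labeled DAG whose context variables have the constant value `c`, and whose
other variables follow `M` in the contexts that cannot be told from `c`, and are constant in all
other contexts. -/
noncomputable def liftContext [Finite V]
    (hdiscrete : ∀ w ∈ G.context, Countable (D w) ∧ DiscreteMeasurableSpace (D w))
    (M : SCM (G.induced c)) : SCM G where
  U := M.U
  mU := M.mU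
  P := M.P
  prob := M.prob
  f w pa u := if h : w ∈ G.context then c ⟨w, h⟩ else
    if G.SameMechanism c w (G.readContext c w pa) then M.f w (fun p => pa ⟨p, p.2.1⟩) u
    else Classical.arbitrary _
  measurable_f w := by
    by_cases h : w ∈ G.context
    · simp only [h, dif_pos]
      exact measurable_const
    · simp only [h, dif_neg, not_false_iff]
      have hread : Measurable (G.readContext c w) :=
        (measurable_restrict G.context).comp (measurable_overwrite_left _ _)
      have hset : MeasurableSet {d | G.SameMechanism c w d} :=
        measurableSet_setOfPred.2 (measurable_comp_context hdiscrete _)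
      refine Measurable.ite ((hread.comp measurable_fst) hset) ?_ measurable_const
      refine (M.measurable_f w).comp (Measurable.prodMk ?_ measurable_snd)
      exact measurable_pi_lambda _ fun p => (measurable_pi_apply _).comp measurable_fst

variable [Finite V]
    (hdiscrete : ∀ w ∈ G.context, Countable (D w) ∧ DiscreteMeasurableSpace (D w))
    (M : SCM (G.induced c))

theorem liftContext_f_context {w : V} (h : w ∈ G.context) (pa : ∀ p : G.Pa w, D p)
    (u : (M.liftContext hdiscrete).U w) : (M.liftContext hdiscrete).f w pa u = c ⟨w, h⟩ := by
  simp [liftContext, h]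

theorem liftContext_f_of_same {w : V} (h : w ∉ G.context) {pa : ∀ p : G.Pa w, D p}
    (hs : G.SameMechanism c w (G.readContext c w pa)) (u : M.U w) :
    (M.liftContext hdiscrete).f w pa u = M.f w (fun p => pa ⟨p, p.2.1⟩) u := by
  simp [liftContext, h, hs]

theorem liftContext_f_of_not_same {w : V} (h : w ∉ G.context) {pa : ∀ p : G.Pa w, D p}
    (hs : ¬ G.SameMechanism c w (G.readContext c w pa)) (u : M.U w) :
    (M.liftContext hdiscrete).f w pa u = Classical.arbitrary _ := by
  simp [liftContext, h, hs]

/-- Two parent assignments related by a label fall into the same branch of the definition. If `M` is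
followed, its mechanism does not read `i`, because the edge from `i` is deleted in the induced
graph. -/
theorem liftContext_compatible : (M.liftContext hdiscrete).Compatible := by
  intro i j l hl pa pa' hpa hpa' hoff
  unfold mechanism
  congr 1
  funext u
  by_cases hj : j ∈ G.context
  · rw [liftContext_f_context hdiscrete M hj, liftContext_f_context hdiscrete M hj]
  have hread : ∀ q : ∀ p : G.Pa j, D p,
      (∀ (p : G.Pa j) (h : (p : V) ∈ l.dom), q p = l.val ⟨p, h⟩) →
      ∀ (w : G.context) (h : (w : V) ∈ l.dom), G.readContext c j q w = l.val ⟨w, h⟩ := by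
    intro q hq w h
    rw [LDAG.readContext_of_edge q (G.label_dom i j l hl w h).1]
    exact hq ⟨w, _⟩ h
  have hne : ∀ w : G.context, (w : V) ≠ i →
      G.readContext c j pa w = G.readContext c j pa' w := by
    intro w hw
    by_cases hwj : G.edge w j
    · rw [LDAG.readContext_of_edge _ hwj, LDAG.readContext_of_edge _ hwj]
      exact hoff ⟨w, hwj⟩ hw
    · rw [LDAG.readContext_of_not_edge _ hwj, LDAG.readContext_of_not_edge _ hwj]
  have hiff : G.SameMechanism c j (G.readContext c j pa) ↔
      G.SameMechanism c j (G.readContext c j pa') :=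
    ⟨LDAG.sameMechanism_of_label hl (hread pa hpa) (hread pa' hpa') fun w _ hw => hne w hw,
      LDAG.sameMechanism_of_label hl (hread pa' hpa') (hread pa hpa) fun w _ hw => (hne w hw).symm⟩
  by_cases hs : G.SameMechanism c j (G.readContext c j pa)
  · refine (liftContext_f_of_same hdiscrete M hj hs u).trans
      (Eq.trans ?_ (liftContext_f_of_same hdiscrete M hj (hiff.1 hs) u).symm)
    congr 1
    funext p
    -- An edge from `i` in the induced graph is impossible: it would be incident to the context, or
    -- absent by `LDAG.absent_of_label`.
    refine hoff _ fun hpi => ?_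
    have hpi' : (p : V) = i := hpi
    by_cases hi : i ∈ G.context
    · exact p.2.2.1 (hpi' ▸ hi)
    · exact p.2.2.2.2 (hpi' ▸ LDAG.absent_of_label hl hi (hread pa hpa) hs)
  · exact (liftContext_f_of_not_same hdiscrete M hj hs u).trans
      (liftContext_f_of_not_same hdiscrete M hj (fun h => hs (hiff.2 h)) u).symm

/-- In the context `c` the lifted model follows `M`. -/
theorem liftContext_f_overwrite {w : V} (h : w ∉ G.context) (a : ∀ v, D v) (u : M.U w) :
    (M.liftContext hdiscrete).f w (fun p => overwrite G.context c a p) u =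
      M.f w (fun p => a p) u := by
  have hread : G.readContext c w (fun p => overwrite G.context c a p) = c := by
    funext v
    by_cases hv : G.edge v w
    · rw [LDAG.readContext_of_edge _ hv]
      exact overwrite_mem _ _ v.2
    · exact LDAG.readContext_of_not_edge _ hv
  rw [liftContext_f_of_same hdiscrete M h (by rw [hread]; exact fun _ _ _ => rfl)]
  congr 1
  funext p
  exact overwrite_notMem _ _ p.2.2.1

/-- The lift only ever meets the context `c`, where it follows `M`. The context values of `M` itself
may be random, but no other mechanism of `M` reads them. -/
theorem sol_liftContext (e : ∀ w, M.U w) :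
    (M.liftContext hdiscrete).sol e = overwrite G.context c (M.sol e) := by
  funext w
  induction w using G.edge_wf.induction with
  | _ w ih =>
    refine ((M.liftContext hdiscrete).sol_apply e w).trans ?_
    have hpa : (fun p : G.Pa w => (M.liftContext hdiscrete).sol e p) =
        fun p : G.Pa w => overwrite G.context c (M.sol e) p := funext fun p => ih p p.2
    rw [hpa]
    by_cases hw : w ∈ G.context
    · rw [overwrite_mem _ _ hw]
      exact liftContext_f_context hdiscrete M hw _ _
    · rw [overwrite_notMem _ _ hw, sol_apply]
      exact liftContext_f_overwrite hdiscrete M hw _ _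

theorem solDo_liftContext {X : V} (hX : X ∉ G.context) (x : D X) (e : ∀ w, M.U w) :
    (M.liftContext hdiscrete).solDo X x e = overwrite G.context c (M.solDo X x e) := by
  funext w
  induction w using G.edge_wf.induction with
  | _ w ih =>
    by_cases hwX : w = X
    · subst hwX
      rw [overwrite_notMem _ _ hX, solDo_self]
      exact (M.liftContext hdiscrete).solDo_self w x e
    refine ((M.liftContext hdiscrete).solDo_of_ne hwX x e).trans ?_
    have hpa : (fun p : G.Pa w => (M.liftContext hdiscrete).solDo X x e p) =
        fun p : G.Pa w => overwrite G.context c (M.solDo X x e) p := funext fun p => ih p p.2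
    rw [hpa]
    by_cases hw : w ∈ G.context
    · rw [overwrite_mem _ _ hw]
      exact liftContext_f_context hdiscrete M hw _ _
    · rw [overwrite_notMem _ _ hw, solDo_of_ne _ hwX]
      exact liftContext_f_overwrite hdiscrete M hw _ _

end SCM

end Lift

/-! ### From the labeled DAG to the contexts -/

/-- The values of the variables in `S`, with those of the variables in `C` replaced by `c`. -/
noncomputable def overwriteOn {V : Type v} {D : V → Type u} (S : Set V) {C : Set V}
    (c : ∀ w : C, D w) (o : ∀ w : S, D w) : ∀ w : S, D w :=
  overwrite (D := fun w : S => D w) (Subtype.val ⁻¹' C) (fun w => c ⟨w.1, w.2⟩) o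

theorem overwriteOn_restrict {V : Type v} {D : V → Type u} (S : Set V) {C : Set V}
    (c : ∀ w : C, D w) (a : ∀ w, D w) :
    overwriteOn S c (fun w => a w) = fun w : S => overwrite C c a w := by
  funext w
  by_cases h : (w : V) ∈ C
  · rw [overwrite_mem _ _ h]
    exact overwrite_mem _ _ (show w ∈ Subtype.val ⁻¹' C from h)
  · rw [overwrite_notMem _ _ h]
    exact overwrite_notMem _ _ (show w ∉ Subtype.val ⁻¹' C from h)

theorem measurable_overwriteOn {V : Type v} {D : V → Type u} [∀ w, MeasurableSpace (D w)]
    (S : Set V) {C : Set V} (c : ∀ w : C, D w) : Measurable (overwriteOn (D := D) S c) :=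
  measurable_overwrite _ _

/-- The policy that pretends that the context variables have the values `c`. -/
noncomputable def pretendPolicy {V : Type v} {D : V → Type u} [∀ w, MeasurableSpace (D w)]
    {X : V} {PaPi C : Set V} (c : ∀ w : C, D w) (π : Policy D X PaPi) : Policy D X PaPi :=
  ⟨π.1.comap (overwriteOn PaPi c) (measurable_overwriteOn PaPi c),
    have := π.2
    Kernel.IsMarkovKernel.comap _ _⟩

/-- A variable that is not affected by the action is imitated by every policy. -/
theorem SCM.doPolicy_map_of_notMem_De {V : Type v} [Fintype V] {D : V → Type u}
    [∀ w, MeasurableSpace (D w)] {G : LDAG D} (M : SCM G) {X Y : V} {PaPi : Set V}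
    (π : Policy D X PaPi) (hY : Y ∉ G.De X) :
    (M.doPolicy π).map (fun a => a Y) = M.law.map (fun a => a Y) := by
  have := π.2
  ext B hB
  have hB' : Measurable fun a : ∀ w, D w => B.indicator (fun _ => (1 : ENNReal)) (a Y) :=
    (measurable_const.indicator hB).comp (measurable_pi_apply Y)
  rw [M.doPolicy_map_apply _ Y hB, M.law_map_apply Y hB, M.lintegral_doPolicy π hB',
    M.lintegral_law hB']
  refine lintegral_congr fun e => ?_
  simp only [M.solDo_of_notMem_De hY, lintegral_const, measure_univ, mul_one]

theorem imitable_induced {V : Type v} [Fintype V] {D : V → Type u}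
    [∀ w, MeasurableSpace (D w)] [∀ w, Nonempty (D w)]
    (G : LDAG D) (O : Set V) (X Y : V) (PaPi : Set V) (hcontext : ∀ w ∈ G.context, w ∉ G.De X)
    (hdiscrete : ∀ w ∈ G.context, Countable (D w) ∧ DiscreteMeasurableSpace (D w))
    (h : Imitable G O X Y PaPi) (c : ∀ w : G.context, D w) :
    Imitable (G.induced c) O X Y PaPi := by
  obtain ⟨Φ, hΦ⟩ := h
  refine ⟨fun P => pretendPolicy c (Φ (P.map (overwriteOn O c))), fun M _ => ?_⟩
  -- A context reward is constant in the lift but possibly random in `M`, so the lift says nothing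
  -- about it; it is, however, unaffected by the action.
  by_cases hY : Y ∈ G.context
  · exact M.doPolicy_map_of_notMem_De _ fun hd => hcontext Y hY (G.De_induced_subset c X hd)
  have hX : X ∉ G.context := fun hX => hcontext X hX Relation.ReflTransGen.refl
  -- The observational law of the lift is computable from that of `M`, as the map `Φ` being
  -- constructed requires.
  have hobs : (M.obs O).map (overwriteOn O c) = (M.liftContext hdiscrete).obs O := by
    unfold SCM.obs SCM.law
    rw [Measure.map_map (measurable_overwriteOn O c) (SCM.measurable_restrict O),
      Measure.map_map ((measurable_overwriteOn O c).comp (SCM.measurable_restrict O))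
        M.measurable_sol,
      Measure.map_map (SCM.measurable_restrict O) (M.liftContext hdiscrete).measurable_sol]
    change M.noise.map _ = M.noise.map _
    congr 1
    funext e
    have he := M.sol_liftContext hdiscrete e
    simp only [Function.comp, overwriteOn_restrict]
    rw [he]
  have key := hΦ (M.liftContext hdiscrete) (M.liftContext_compatible hdiscrete)
  beta_reduce
  rw [hobs]
  generalize Φ ((M.liftContext hdiscrete).obs O) = π at key
  ext B hB
  have hB' : Measurable fun a : ∀ w, D w => B.indicator (fun _ => (1 : ENNReal)) (a Y) :=
    (measurable_const.indicator hB).comp (measurable_pi_apply Y)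
  have key' := congrArg (fun μ => μ B) key
  rw [SCM.doPolicy_map_apply _ _ Y hB, SCM.law_map_apply _ Y hB, SCM.lintegral_doPolicy _ _ hB',
    SCM.lintegral_law _ hB'] at key' ⊢
  refine Eq.trans ?_ (key'.trans ?_)
  · change ∫⁻ e, _ ∂M.noise = ∫⁻ e, _ ∂M.noise
    refine lintegral_congr fun e => ?_
    rw [M.sol_liftContext hdiscrete e]
    change ∫⁻ x, _ ∂(π.1 (overwriteOn PaPi c fun w => M.sol e w)) = _
    rw [overwriteOn_restrict]
    refine lintegral_congr fun x => ?_
    rw [M.solDo_liftContext hdiscrete hX x e, overwrite_notMem _ _ hY]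
  · change ∫⁻ e, _ ∂M.noise = ∫⁻ e, _ ∂M.noise
    refine lintegral_congr fun e => ?_
    rw [M.sol_liftContext hdiscrete e, overwrite_notMem _ _ hY]

end CSIImitation

open CSIImitation in
theorem mainTheorem2 {V : Type v} [Fintype V] {D : V → Type u}
    [∀ w, MeasurableSpace (D w)] [∀ w, Nonempty (D w)]
    (G : LDAG D) (O : Set V) (X Y : V) (PaPi : Set V)
    (hX : X ∈ O)
    (hPaPi : PaPi ⊆ O \ G.De X)
    (hdiscrete : ∀ w ∈ G.context, Countable (D w) ∧ DiscreteMeasurableSpace (D w))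
    (hcontext : G.context ⊆ PaPi)
    (hparents : ∀ w ∈ G.context, G.Pa w ⊆ G.context) :
    Imitable G O X Y PaPi ↔
      ∀ c : (∀ w : G.context, D w), Imitable (G.induced c) O X Y PaPi :=
  ⟨fun h c => imitable_induced G O X Y PaPi (fun _ hw => (hPaPi (hcontext hw)).2) hdiscrete h c,
    imitable_of_forall_induced G O X Y PaPi hPaPi hdiscrete hcontext hparents⟩
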